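/- **Setting.** Let $T\ge 2$ be the number of targets and $K\in\mathbb N$ the number of defender resources. Let $X=\{x\in[0,1]^T:\sum_i x_i\le K\}$, let $Y=\{1,\dots,T\}$ (the attacked target), and let $M>0$ be fixed. For $a\in\mathbb R^{T-1}$ put $a_T=0$ and let the loss be $l(y,a)=-\log\frac{e^{a_y}}{1+\sum_{j=1}^{T-1}e^{a_j}}$. For $h:X\to\mathbb R^{T-1}$, a probability measure $p$ on $X\times Y$ and a sample $\vec z=((x_1,y_1),\dots,(x_m,y_m))$, the true risk is $r_h(p)=\int l(y,h(x))\,dp(x,y)$ and the empirical risk is $\hat r_h(\vec z)=\frac1m\sum_{j}l(y_j,h(x_j))$. The generalized SUQR class $\mathcal H$ consists of all $h=\langle h_1,\dots,h_{T-1}\rangle$ with $h_i(x)=w(x_i-x_T)+c_i$ on $X$, where $w,c_1,\dots,c_{T-1}\in\mathbb R$ are such that the functions $w(x_i-x_T)$ and the constants $c_i$ all have values in $[-\frac M4,\frac M4]$ (so $h_i$ has values in $[-\frac M2,\frac M2]$). Let $\mathcal G$ be the class of functions $x\mapsto\langle w(x_1-x_T),\dots,w(x_{T-1}-x_T)\rangle$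 with one common weight $w$ and components with values in $[-\frac M4,\frac M4]$, and let $\mathcal F_i$ ($1\le i\le T-1$) be the class of constant functions on $X$ with value in $[-\frac M4,\frac M4]$. For a class $\mathcal E$ of functions on $X$ and a pseudo-metric $d$ on their range, the capacity $\mathcal C(\varepsilon,\mathcal E,d)$ is the supremum, over all probability measures $P$ on $X$, of the least size of a finite $\mathcal U\subseteq\mathcal E$ such that every $h\in\mathcal E$ has some $f\in\mathcal U$ with $\int_X d(f(x),h(x))\,dP(x)\le\varepsilon$. Let $d_{l_1}(s,t)=|s-t|$ on $\mathbb R$ and $\bar d_{l_1}(a,b)=\frac1{T-1}\sum_{i}|a_i-b_i|$ on $\mathbb R^{T-1}$. A class is $(\alpha,\delta)$-PAC learnable from $m$ samples if there is an algorithm $\mathcal A$, mapping samples of size $m$ to elements of $\mathcal H$, such that for every probability measure $p$ on $X\times Y$ and $m$ independent draws from $p$, (1) $\Pr(\forall h\in\mathcal H:\ |\hat r_h(\vec z)-r_h(p)|<\frac\alpha3)>1-\frac\delta2$ and (2) $\Pr(|\hat r_{\mathcal A(\vec z)}(\vec z)-\inf_{h\in\mathcal H}\hat r_h(\vec z)|<\frac\alpha3)>1-\frac\delta2$.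 The sample complexity of $\mathcal H$ is the least $m_0$ such that $\mathcal H$ is $(\alpha,\delta)$-PAC learnable from $m$ samples for every $m\ge m_0$. (For an event $E$ that need not be measurable, $\Pr(E)>1-\eta$ means that the complement of $E$ has outer probability less than $\eta$.) **Theorem.** 1. $\mathcal H=\mathcal G\oplus(\times_i\mathcal F_i)$, that is, $\mathcal H$ is the set of all $\langle g_1+f_1,\dots,g_{T-1}+f_{T-1}\rangle$ with $\langle g_1,\dots,g_{T-1}\rangle\in\mathcal G$ and $f_i\in\mathcal F_i$. 2. For every $\varepsilon>0$, $$\mathcal C(\varepsilon,\mathcal H,\bar d_{l_1})\le\mathcal C(\tfrac\varepsilon2,\mathcal G,\bar d_{l_1})\prod_{i=1}^{T-1}\mathcal C(\tfrac\varepsilon2,\mathcal F_i,d_{l_1}),$$ $$\mathcal C(\varepsilon,\mathcal G,\bar d_{l_1})\le\Big\lceil\frac M{4\varepsilon}\Big\rceil,\qquad \mathcal C(\varepsilon,\mathcal F_i,d_{l_1})\le\Big\lceil\frac M{4\varepsilon}\Big\rceil,\qquad \mathcal C(\varepsilon,\mathcal H,\bar d_{l_1})\le\Big\lceil\frac M{2\varepsilon}\Big\rceil^{T}.$$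 3. There is a constant $C>0$ that depends only on $M$ such that for all $T\ge2$, all $K$, all $0<\alpha\le T/2$ and all $0<\delta<1$, the sample complexity of $\mathcal H$ is at most $$\Big\lceil C\cdot\frac1{\alpha^2}\Big(\log\frac1\delta+T\log\frac T\alpha\Big)\Big\rceil ,$$ that is, it is $O\big(\frac1{\alpha^2}(\log\frac1\delta+T\log\frac T\alpha)\big)$. Moreover, for every $m$ that is at least the sample complexity, every $p$, and every algorithm $\mathcal A$ with values in $\mathcal H$ that satisfies (2) for $p$, one has $\Pr(|r_{\mathcal A(\vec z)}(p)-\inf_{h\in\mathcal H}r_h(p)|<\alpha)>1-\delta$. -/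

import Mathlib

open MeasureTheory

noncomputable section

namespace SUQR

/-! There are `T = n + 1` targets, indexed by `Fin (n + 1)`; the reference target `T` is
`Fin.last n`, and the other `T - 1 = n` targets are `i.castSucc` for `i : Fin n`. -/

/-- The instance space: defender mixed strategies, written as coverage probabilities, with `K`
resources. It carries the Borel sigma-algebra inherited from the product. -/
abbrev Strategy (n K : ℕ) : Type :=
  {x : Fin (n + 1) → ℝ // (∀ i, 0 ≤ x i ∧ x i ≤ 1) ∧ ∑ i, x i ≤ (K : ℝ)}

/-- The outcome space: the attacked target (discrete sigma-algebra). -/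
abbrev Outcome (n : ℕ) : Type := Fin (n + 1)

/-- The decision space: the exponents of the first `T - 1` targets. -/
abbrev Decision (n : ℕ) : Type := Fin n → ℝ

/-- Labelled data points. -/
abbrev Datum (n K : ℕ) : Type := Strategy n K × Outcome n

/-- The difference `x_i - x_T`. -/
def relCoverage {n K : ℕ} (x : Strategy n K) (i : Fin n) : ℝ :=
  x.1 i.castSucc - x.1 (Fin.last n)

/-! ### Loss and risks -/

/-- The predicted attack probability of target `y`: `exp a_y / (1 + ∑_{j < T} exp a_j)`,
with `a_T = 0`. -/
def attackProb {n : ℕ} (a : Decision n) (y : Outcome n) : ℝ :=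
  Real.exp ((Fin.snoc a 0 : Fin (n + 1) → ℝ) y) / (1 + ∑ j, Real.exp (a j))

/-- The negative log-likelihood loss. -/
def loss {n : ℕ} (y : Outcome n) (a : Decision n) : ℝ := -Real.log (attackProb a y)

/-- True risk of the hypothesis `h` under the data distribution `p`. -/
def trueRisk {n K : ℕ} (p : Measure (Datum n K)) (h : Strategy n K → Decision n) : ℝ :=
  ∫ z, loss z.2 (h z.1) ∂p

/-- Empirical risk of the hypothesis `h` on the sample `z`. -/
def empRisk {n K m : ℕ} (z : Fin m → Datum n K) (h : Strategy n K → Decision n) : ℝ :=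
  (1 / (m : ℝ)) * ∑ j, loss (z j).2 (h (z j).1)

/-- The law of `m` independent draws from `p`. -/
def sampleLaw {n K : ℕ} (p : Measure (Datum n K)) (m : ℕ) : Measure (Fin m → Datum n K) :=
  Measure.pi fun _ => p

/-! ### PAC learnability

A requirement `Pr(E) > 1 - η` is written as `Pr(not E) < η`; no measurability of `E` is
assumed, and `Pr` is then the outer measure, so that this is the strong reading. -/

/-- First pre-condition: with probability more than `1 - δ/2`, all hypotheses have empirical
risk `α/3`-close to their true risk. -/
def UniformlyConverges {n K : ℕ} (H : Set (Strategy n K → Decision n)) (α δ : ℝ) (m : ℕ)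
    (p : Measure (Datum n K)) : Prop :=
  sampleLaw p m {z | ¬ ∀ h ∈ H, |empRisk z h - trueRisk p h| < α / 3} < ENNReal.ofReal (δ / 2)

/-- Second pre-condition: with probability more than `1 - δ/2`, the output of the algorithm has
empirical risk `α/3`-close to the least empirical risk. -/
def MinimizesEmpRisk {n K : ℕ} (H : Set (Strategy n K → Decision n)) (α δ : ℝ) (m : ℕ)
    (p : Measure (Datum n K)) (A : (Fin m → Datum n K) → Strategy n K → Decision n) : Prop :=
  sampleLaw p m {z | ¬ |empRisk z (A z) - sInf (empRisk z '' H)| < α / 3} < ENNReal.ofReal (δ / 2)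

/-- `H` is `(α, δ)`-PAC learnable from `m` samples: some learning algorithm with values in `H`
satisfies, together with `H`, the two pre-conditions for every data distribution. -/
def PACLearnable {n K : ℕ} (H : Set (Strategy n K → Decision n)) (α δ : ℝ) (m : ℕ) : Prop :=
  ∃ A : (Fin m → Datum n K) → Strategy n K → Decision n, (∀ z, A z ∈ H) ∧
    ∀ p : Measure (Datum n K), IsProbabilityMeasure p →
      UniformlyConverges H α δ m p ∧ MinimizesEmpRisk H α δ m p A

/-- With probability more than `1 - δ`, the output of the algorithm has true risk `α`-close to
the least true risk in `H`. -/
def HasPACGuarantee {n K : ℕ} (H : Set (Strategy n K → Decision n)) (α δ : ℝ) (m : ℕ)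
    (p : Measure (Datum n K)) (A : (Fin m → Datum n K) → Strategy n K → Decision n) : Prop :=
  sampleLaw p m {z | ¬ |trueRisk p (A z) - sInf (trueRisk p '' H)| < α} < ENNReal.ofReal δ

/-- The sample complexity: the least `m₀` such that `H` is `(α, δ)`-PAC learnable from every
number `m ≥ m₀` of samples (`⊤` if there is none). -/
def sampleComplexity {n K : ℕ} (H : Set (Strategy n K → Decision n)) (α δ : ℝ) : ℕ∞ :=
  ⨅ (m₀ : ℕ) (_ : ∀ m, m₀ ≤ m → PACLearnable H α δ m), (m₀ : ℕ∞)

/-! ### Covering numbers and capacity -/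

/-- The `l₁` distance on `ℝ`. -/
def absDist (a b : ℝ) : ℝ := |a - b|

/-- The average `l₁` distance on `ℝⁿ`. -/
def avgDist {n : ℕ} (a b : Decision n) : ℝ := (∑ i, |a i - b i|) / n

/-- The pseudo-metric `d_{L¹(P, d)}` on functions. -/
def l1Dist {X B : Type*} [MeasurableSpace X] (P : Measure X) (d : B → B → ℝ) (f g : X → B) : ℝ :=
  ∫ x, d (f x) (g x) ∂P

/-- `U` is a finite `ε`-cover of `H`, with centres in `H`, for the pseudo-metric `ρ`. -/
def IsEpsCover {E : Type*} (ε : ℝ) (H : Set E) (ρ : E → E → ℝ) (U : Finset E) : Prop :=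
  (U : Set E) ⊆ H ∧ ∀ h ∈ H, ∃ f ∈ U, ρ f h ≤ ε

/-- The size of the smallest `ε`-cover (`⊤` if there is no finite one). -/
def coveringNumber {E : Type*} (ε : ℝ) (H : Set E) (ρ : E → E → ℝ) : ℕ∞ :=
  ⨅ (U : Finset E) (_ : IsEpsCover ε H ρ U), (U.card : ℕ∞)

/-- The capacity: the supremum over all probability measures `P` on `X` of the covering numbers
for `d_{L¹(P, d)}`. -/
def capacity {X B : Type*} [MeasurableSpace X] (ε : ℝ) (H : Set (X → B)) (d : B → B → ℝ) : ℕ∞ :=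
  ⨆ (P : Measure X) (_ : IsProbabilityMeasure P), coveringNumber ε H (l1Dist P d)

/-! ### The hypothesis classes -/

/-- The shared-weight class `G`: functions `x ↦ (w (x_i - x_T))_i` with one weight `w` and
values in `[-M/4, M/4]`. -/
def weightClass (n K : ℕ) (M : ℝ) : Set (Strategy n K → Decision n) :=
  {g | ∃ w : ℝ, (∀ x i, g x i = w * relCoverage x i) ∧ ∀ x i, |g x i| ≤ M / 4}

/-- The class of constant functions with value in `[-M/4, M/4]`. -/
def constClass (n K : ℕ) (M : ℝ) : Set (Strategy n K → ℝ) :=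
  {f | ∃ c : ℝ, (∀ x, f x = c) ∧ |c| ≤ M / 4}

/-- The direct-sum semi-free product `G ⊕ (×_i F_i)`. -/
def semiFreeSum {n : ℕ} {X : Type*} (G : Set (X → Decision n)) (F : Fin n → Set (X → ℝ)) :
    Set (X → Decision n) :=
  {h | ∃ g ∈ G, ∃ f : Fin n → X → ℝ, (∀ i, f i ∈ F i) ∧ ∀ x i, h x i = g x i + f i x}

/-- The generalized SUQR class: functions `h` with `h_i(x) = w (x_i - x_T) + c_i`, where the
terms `w (x_i - x_T)` and `c_i` have values in `[-M/4, M/4]` (so `h_i` has values in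
`[-M/2, M/2]`). -/
def suqrClass (n K : ℕ) (M : ℝ) : Set (Strategy n K → Decision n) :=
  {h | ∃ (w : ℝ) (c : Fin n → ℝ), (∀ x i, h x i = w * relCoverage x i + c i) ∧
    (∀ (x : Strategy n K) i, |w * relCoverage x i| ≤ M / 4) ∧ ∀ i, |c i| ≤ M / 4}

end SUQR

end

/-!
The decomposition of the SUQR class into weights and constants is a regrouping of the definition.

The weight class and the constant classes are images of the interval `[-M/4, M/4]` under maps that
are `1`-Lipschitz for every `L¹(P)` distance, since coverage differences lie in `[-1, 1]`
(`exists_abs_le_weight` recovers the bound on the weight itself). Midpoints of equal subintervals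
therefore give covers of size `⌈M / (4ε)⌉` (`exists_finset_cover_abs_le`), and sums of centres
cover a semi-free sum (`coveringNumber_semiFreeSum_le`).

For the sample complexity, two properties of the loss matter: it is `2`-Lipschitz in the sup
distance of the exponents (`abs_loss_sub_loss_le`), and, although it grows with the number of
targets `T`, its values stay within `M` of `log T` (`loss_mem_Icc`). The second one makes
Hoeffding's inequality hold with a constant depending on `M` only; the first one reduces uniform
convergence, with no measurability issue for the supremum, to a union bound over a sup-norm grid
of at most `⌈9M / α⌉ ^ T` hypotheses (`uniformlyConverges_suqrClass`). Since `T / α ≥ 2`, the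
logarithm of the grid size is `O(T log (T / α))` (`grid_card_mul_exp_lt`). Approximate empirical
minimizers exist on every sample, so uniform convergence gives learnability; conversely
learnability contains uniform convergence, and three errors of size `α / 3` add up to the final
guarantee (`hasPACGuarantee_of_uniformlyConverges`).
-/

namespace SUQR

/-! ### Covers of the weight class, the constants and their sum -/

/-- Midpoints of `⌈r / ε⌉` subintervals of equal length cover `[-r, r]` with radius `ε`. -/
theorem exists_finset_cover_abs_le {r ε : ℝ} (hr : 0 < r) (hε : 0 < ε) :
    ∃ S : Finset ℝ, S.card ≤ ⌈r / ε⌉₊ ∧ (∀ s ∈ S, |s| ≤ r) ∧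
      ∀ t, |t| ≤ r → ∃ s ∈ S, |s - t| ≤ ε := by
  set N := ⌈r / ε⌉₊ with hN
  have hN0 : 0 < N := Nat.ceil_pos.2 (div_pos hr hε)
  have hNR : (0 : ℝ) < N := by exact_mod_cast hN0
  have hle : r / N ≤ ε := by
    have : r / ε ≤ N := Nat.le_ceil _
    rw [div_le_iff₀ hε] at this
    rw [div_le_iff₀ hNR]; linarith
  refine ⟨(Finset.range N).image fun k : ℕ => -r + (2 * k + 1) * (r / N),
    Finset.card_image_le.trans (by simp), ?_, ?_⟩
  · intro s hs
    obtain ⟨k, hk, rfl⟩ := Finset.mem_image.1 hs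
    have hk' : (k : ℝ) + 1 ≤ N := by exact_mod_cast Finset.mem_range.1 hk
    have hrN : 0 < r / N := div_pos hr hNR
    have hrr : (N : ℝ) * (r / N) = r := by field_simp
    have hk0 : (0 : ℝ) ≤ k := Nat.cast_nonneg k
    rw [abs_le]
    constructor <;> nlinarith
  · intro t ht
    rw [abs_le] at ht
    set u := (t + r) * N / (2 * r) with hu
    have hu0 : 0 ≤ u := div_nonneg (mul_nonneg (by linarith) hNR.le) (by linarith)
    have huN : u ≤ N := by
      rw [hu, div_le_iff₀ (by linarith)]; nlinarith
    obtain ⟨k, hk, hku, huk⟩ : ∃ k < N, (k : ℝ) ≤ u ∧ u ≤ k + 1 := by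
      rcases huN.lt_or_eq with h | h
      · exact ⟨⌊u⌋₊, (Nat.floor_lt hu0).2 h, Nat.floor_le hu0, (Nat.lt_floor_add_one u).le⟩
      · refine ⟨N - 1, by omega, ?_, ?_⟩ <;> rw [h, Nat.cast_pred hN0] <;> linarith
    refine ⟨_, Finset.mem_image.2 ⟨k, Finset.mem_range.2 hk, rfl⟩, le_trans ?_ hle⟩
    -- In the coordinate `u`, the subinterval of index `k` is `[k, k + 1]`.
    have htu : t = -r + 2 * u * (r / N) := by rw [hu]; field_simp; ring
    have hrN : 0 < r / N := div_pos hr hNR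
    rw [htu, abs_le]
    constructor <;> nlinarith

theorem coveringNumber_le {E : Type*} {ε : ℝ} {H : Set E} {ρ : E → E → ℝ} {U : Finset E}
    (hU : IsEpsCover ε H ρ U) : coveringNumber ε H ρ ≤ U.card :=
  iInf₂_le U hU

theorem exists_isEpsCover_card_eq {E : Type*} {ε : ℝ} {H : Set E} {ρ : E → E → ℝ}
    (h : coveringNumber ε H ρ ≠ ⊤) :
    ∃ U : Finset E, IsEpsCover ε H ρ U ∧ (U.card : ℕ∞) = coveringNumber ε H ρ := by
  have hne : Nonempty {U : Finset E // IsEpsCover ε H ρ U} := by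
    by_contra hcon
    refine h (iInf₂_eq_top.2 fun U hU => (hcon ⟨⟨U, hU⟩⟩).elim)
  obtain ⟨U, hU⟩ := ENat.exists_eq_iInf
    (fun U : {U : Finset E // IsEpsCover ε H ρ U} => ((U : Finset E).card : ℕ∞))
  refine ⟨U, U.2, hU.trans ?_⟩
  rw [coveringNumber, iInf_subtype']

theorem abs_relCoverage_le {n K : ℕ} (x : Strategy n K) (i : Fin n) : |relCoverage x i| ≤ 1 := by
  have h1 := x.2.1 i.castSucc
  have h2 := x.2.1 (Fin.last n)
  rw [relCoverage, abs_le]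
  constructor <;> linarith

theorem measurable_relCoverage {n K : ℕ} (i : Fin n) :
    Measurable fun x : Strategy n K => relCoverage x i :=
  ((measurable_pi_apply _).comp measurable_subtype_coe).sub
    ((measurable_pi_apply _).comp measurable_subtype_coe)

/-- A weight with bounded contributions may be replaced by a bounded weight. With at least one
resource, covering one target fully shows that the weight itself is bounded; without resources
every contribution vanishes. -/
theorem exists_abs_le_weight {n K : ℕ} {r w : ℝ} (hr : 0 ≤ r)
    (h : ∀ (x : Strategy n K) i, |w * relCoverage x i| ≤ r) :
    ∃ v : ℝ, |v| ≤ r ∧ ∀ (x : Strategy n K) i, w * relCoverage x i = v * relCoverage x i := by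
  rcases n.eq_zero_or_pos with rfl | hn
  · exact ⟨0, by simpa using hr, fun x i => i.elim0⟩
  rcases K.eq_zero_or_pos with rfl | hK
  · refine ⟨0, by simpa using hr, fun x i => ?_⟩
    have hx : ∀ j, x.1 j = 0 := by
      have hs : ∑ j, x.1 j = 0 :=
        le_antisymm (by simpa using x.2.2) (Finset.sum_nonneg fun j _ => (x.2.1 j).1)
      intro j
      exact (Finset.sum_eq_zero_iff_of_nonneg fun j _ => (x.2.1 j).1).1 hs j (Finset.mem_univ j)
    simp [relCoverage, hx]
  · refine ⟨w, ?_, fun _ _ => rfl⟩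
    let i : Fin n := ⟨0, hn⟩
    let x : Strategy n K := ⟨Pi.single i.castSucc 1, fun j => by
        by_cases hj : j = i.castSucc
        · subst hj; simp
        · simp [hj], by
        simpa using (by exact_mod_cast hK : (1 : ℝ) ≤ K)⟩
    have hx : relCoverage x i = 1 := by
      have : Fin.last n ≠ i.castSucc := (Fin.castSucc_lt_last i).ne'
      simp [relCoverage, x, this]
    simpa [hx] using h x i

theorem avgDist_le {n : ℕ} {a b : Decision n} {r : ℝ} (hr : 0 ≤ r)
    (h : ∀ i, |a i - b i| ≤ r) : avgDist a b ≤ r := by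
  rw [avgDist]
  rcases n.eq_zero_or_pos with rfl | hn
  · simpa using hr
  · rw [div_le_iff₀ (by exact_mod_cast hn)]
    calc ∑ i, |a i - b i| ≤ ∑ _i : Fin n, r := Finset.sum_le_sum fun i _ => h i
      _ = r * n := by simp [mul_comm]

theorem l1Dist_le_of_forall_le {X B : Type*} [MeasurableSpace X] {P : Measure X}
    [IsProbabilityMeasure P] {d : B → B → ℝ} {f g : X → B} {r : ℝ}
    (hd : ∀ x, 0 ≤ d (f x) (g x)) (h : ∀ x, d (f x) (g x) ≤ r) : l1Dist P d f g ≤ r := by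
  have := integral_mono_of_nonneg (μ := P) (Filter.Eventually.of_forall hd)
    (integrable_const r) (Filter.Eventually.of_forall h)
  simpa [l1Dist] using this

theorem capacity_weightClass_le (n K : ℕ) {M ε : ℝ} (hM : 0 < M) (hε : 0 < ε) :
    capacity ε (weightClass n K M) avgDist ≤ (⌈M / (4 * ε)⌉₊ : ℕ∞) := by
  classical
  refine iSup₂_le fun P hP => ?_
  obtain ⟨S, hcard, hS, hcov⟩ := exists_finset_cover_abs_le (r := M / 4) (by positivity) hε
  refine (coveringNumber_le (U := S.image fun w x i => w * relCoverage x i) ⟨?_, ?_⟩).trans ?_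
  · intro g hg
    obtain ⟨w, hw, rfl⟩ := Finset.mem_image.1 (Finset.mem_coe.1 hg)
    refine ⟨w, fun _ _ => rfl, fun x i => ?_⟩
    rw [abs_mul]
    exact (mul_le_of_le_one_right (abs_nonneg _) (abs_relCoverage_le x i)).trans (hS w hw)
  · rintro g ⟨w, hg, hgM⟩
    obtain ⟨v, hv, hwv⟩ := exists_abs_le_weight (n := n) (K := K) (w := w) (r := M / 4)
      (by positivity) fun x i => by rw [← hg]; exact hgM x i
    obtain ⟨s, hs, hsv⟩ := hcov v hv
    refine ⟨_, Finset.mem_image_of_mem _ hs, l1Dist_le_of_forall_le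
      (fun x => div_nonneg (Finset.sum_nonneg fun _ _ => abs_nonneg _) n.cast_nonneg)
      fun x => avgDist_le hε.le fun i => ?_⟩
    rw [hg, hwv, ← sub_mul, abs_mul]
    exact (mul_le_of_le_one_right (abs_nonneg _) (abs_relCoverage_le x i)).trans hsv
  · rw [div_div] at hcard
    exact_mod_cast Finset.card_image_le.trans hcard

theorem capacity_constClass_le (n K : ℕ) {M ε : ℝ} (hM : 0 < M) (hε : 0 < ε) :
    capacity ε (constClass n K M) absDist ≤ (⌈M / (4 * ε)⌉₊ : ℕ∞) := by
  classical
  refine iSup₂_le fun P hP => ?_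
  obtain ⟨S, hcard, hS, hcov⟩ := exists_finset_cover_abs_le (r := M / 4) (by positivity) hε
  refine (coveringNumber_le (U := S.image fun c _ => c) ⟨?_, ?_⟩).trans ?_
  · intro f hf
    obtain ⟨c, hc, rfl⟩ := Finset.mem_image.1 (Finset.mem_coe.1 hf)
    exact ⟨c, fun _ => rfl, hS c hc⟩
  · rintro f ⟨c, hf, hc⟩
    obtain ⟨s, hs, hsc⟩ := hcov c hc
    refine ⟨_, Finset.mem_image_of_mem _ hs, l1Dist_le_of_forall_le
      (fun x => abs_nonneg _) fun x => ?_⟩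
    rw [hf]; exact hsc
  · rw [div_div] at hcard
    exact_mod_cast Finset.card_image_le.trans hcard

theorem suqrClass_eq_semiFreeSum (n K : ℕ) (M : ℝ) :
    suqrClass n K M = semiFreeSum (weightClass n K M) (fun _ => constClass n K M) := by
  ext h
  constructor
  · rintro ⟨w, c, hh, hw, hc⟩
    exact ⟨fun x i => w * relCoverage x i, ⟨w, fun _ _ => rfl, hw⟩, fun i _ => c i,
      fun i => ⟨c i, fun _ => rfl, hc i⟩, hh⟩
  · rintro ⟨g, ⟨w, hg, hgM⟩, f, hf, hh⟩
    choose c hfc hc using hf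
    exact ⟨w, c, fun x i => by rw [hh, hg, hfc], fun x i => by rw [← hg]; exact hgM x i, hc⟩

/-- Sums of centres cover the semi-free sum: the distance of two sums is at most the distance of
the first summands plus the average of the distances of the second ones. -/
theorem coveringNumber_semiFreeSum_le {n : ℕ} (hn : 1 ≤ n) {X : Type*} [MeasurableSpace X]
    {P : Measure X} {G : Set (X → Decision n)} {F : Fin n → Set (X → ℝ)} {ε₁ ε₂ : ℝ}
    (hG : ∀ g ∈ G, ∀ i, Integrable (fun x => g x i) P) (hF : ∀ i, ∀ f ∈ F i, Integrable f P)
    (hG' : coveringNumber ε₁ G (l1Dist P avgDist) ≠ ⊤)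
    (hF' : ∀ i, coveringNumber ε₂ (F i) (l1Dist P absDist) ≠ ⊤) :
    coveringNumber (ε₁ + ε₂) (semiFreeSum G F) (l1Dist P avgDist) ≤
      coveringNumber ε₁ G (l1Dist P avgDist) *
        ∏ i, coveringNumber ε₂ (F i) (l1Dist P absDist) := by
  classical
  obtain ⟨U, ⟨hUG, hU⟩, hUcard⟩ := exists_isEpsCover_card_eq hG'
  choose V hV hVcard using fun i => exists_isEpsCover_card_eq (hF' i)
  have hnR : (0 : ℝ) < n := by exact_mod_cast hn
  refine (coveringNumber_le (U := (U ×ˢ Fintype.piFinset V).image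
    fun q x i => q.1 x i + q.2 i x) ⟨?_, ?_⟩).trans ?_
  · intro h hh
    obtain ⟨q, hq, rfl⟩ := Finset.mem_image.1 (Finset.mem_coe.1 hh)
    rw [Finset.mem_product, Fintype.mem_piFinset] at hq
    exact ⟨q.1, hUG hq.1, q.2, fun i => (hV i).1 (hq.2 i), fun _ _ => rfl⟩
  · rintro h ⟨g, hg, f, hf, hh⟩
    obtain ⟨u, hu, hug⟩ := hU g hg
    choose v hv hvf using fun i => (hV i).2 (f i) (hf i)
    refine ⟨_, Finset.mem_image_of_mem _ (Finset.mem_product.2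
      (show (u, v).1 ∈ U ∧ (u, v).2 ∈ _ from ⟨hu, Fintype.mem_piFinset.2 hv⟩)),
      le_trans ?_ (add_le_add hug (?_ : (∑ i, l1Dist P absDist (v i) (f i)) / n ≤ ε₂))⟩
    · have hi1 : ∀ i, Integrable (fun x => |u x i - g x i|) P := fun i =>
        ((hG u (hUG hu) i).sub (hG g hg i)).abs
      have hi2 : ∀ i, Integrable (fun x => |v i x - f i x|) P := fun i =>
        ((hF i _ ((hV i).1 (hv i))).sub (hF i _ (hf i))).abs
      simp only [l1Dist, avgDist, absDist]
      rw [← integral_finsetSum _ fun i _ => hi2 i, ← integral_div, ← integral_add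
        ((integrable_finsetSum _ fun i _ => hi1 i).div_const _)
        ((integrable_finsetSum _ fun i _ => hi2 i).div_const _)]
      refine integral_mono_of_nonneg (Filter.Eventually.of_forall fun x =>
        div_nonneg (Finset.sum_nonneg fun _ _ => abs_nonneg _) hnR.le)
        (((integrable_finsetSum _ fun i _ => hi1 i).div_const _).add
          ((integrable_finsetSum _ fun i _ => hi2 i).div_const _))
        (Filter.Eventually.of_forall fun x => ?_)
      simp only
      rw [← add_div, ← Finset.sum_add_distrib]
      gcongr with i
      rw [hh, add_sub_add_comm]
      exact abs_add_le _ _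
    · rw [div_le_iff₀ hnR]
      calc ∑ i, l1Dist P absDist (v i) (f i) ≤ ∑ _i : Fin n, ε₂ :=
            Finset.sum_le_sum fun i _ => hvf i
        _ = ε₂ * n := by simp [mul_comm]
  · rw [← hUcard]
    simp_rw [← hVcard]
    refine (Nat.cast_le.2 Finset.card_image_le).trans_eq ?_
    rw [Finset.card_product, Fintype.card_piFinset]
    push_cast
    rfl

theorem coveringNumber_le_capacity {X B : Type*} [MeasurableSpace X] (ε : ℝ) (H : Set (X → B))
    (d : B → B → ℝ) (P : Measure X) [hP : IsProbabilityMeasure P] :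
    coveringNumber ε H (l1Dist P d) ≤ capacity ε H d :=
  le_iSup₂ (f := fun (P : Measure X) (_ : IsProbabilityMeasure P) =>
    coveringNumber ε H (l1Dist P d)) P hP

theorem capacity_suqrClass_le_mul {n : ℕ} (hn : 1 ≤ n) (K : ℕ) {M ε : ℝ} (hM : 0 < M)
    (hε : 0 < ε) :
    capacity ε (suqrClass n K M) avgDist ≤ capacity (ε / 2) (weightClass n K M) avgDist *
      ∏ _i : Fin n, capacity (ε / 2) (constClass n K M) absDist := by
  refine iSup₂_le fun P hP => ?_
  have hG := coveringNumber_le_capacity (ε / 2) (weightClass n K M) avgDist P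
  have hF := coveringNumber_le_capacity (ε / 2) (constClass n K M) absDist P
  rw [suqrClass_eq_semiFreeSum]
  conv_lhs => rw [← add_halves ε]
  refine (coveringNumber_semiFreeSum_le hn ?_ ?_ ?_ ?_).trans
    (mul_le_mul' hG (Finset.prod_le_prod' fun _ _ => hF))
  · rintro g ⟨w, hg, hgM⟩ i
    refine Integrable.of_bound (C := M / 4) ?_ (Filter.Eventually.of_forall fun x => hgM x i)
    simp_rw [hg]
    exact ((measurable_relCoverage i).const_mul w).aestronglyMeasurable
  · rintro i f ⟨c, hf, -⟩
    rw [funext hf]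
    exact integrable_const c
  · exact ne_top_of_le_ne_top (ENat.natCast_ne_top _)
      (hG.trans (capacity_weightClass_le n K hM (half_pos hε)))
  · exact fun _ => ne_top_of_le_ne_top (ENat.natCast_ne_top _)
      (hF.trans (capacity_constClass_le n K hM (half_pos hε)))

theorem capacity_suqrClass_le {n : ℕ} (hn : 1 ≤ n) (K : ℕ) {M ε : ℝ} (hM : 0 < M)
    (hε : 0 < ε) :
    capacity ε (suqrClass n K M) avgDist ≤ (⌈M / (2 * ε)⌉₊ : ℕ∞) ^ (n + 1) := by
  have h4 : M / (4 * (ε / 2)) = M / (2 * ε) := by ring_nf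
  refine (capacity_suqrClass_le_mul hn K hM hε).trans ?_
  have hG := capacity_weightClass_le n K hM (half_pos hε)
  have hF := capacity_constClass_le n K hM (half_pos hε)
  rw [h4] at hG hF
  rw [pow_succ', Finset.prod_const, Finset.card_univ, Fintype.card_fin]
  exact mul_le_mul' hG (pow_le_pow_left' hF n)

/-! ### The loss: Lipschitz bound, range and measurability -/

theorem loss_eq {n : ℕ} (y : Outcome n) (a : Decision n) :
    loss y a = Real.log (1 + ∑ j, Real.exp (a j)) - (Fin.snoc a 0 : Fin (n + 1) → ℝ) y := by
  have h : 0 < 1 + ∑ j, Real.exp (a j) := by positivity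
  rw [loss, attackProb, Real.log_div (Real.exp_ne_zero _) h.ne', Real.log_exp]
  ring

/-- The log-partition function is `1`-Lipschitz for the sup distance. -/
theorem log_one_add_sum_exp_le {n : ℕ} {a b : Decision n} {r : ℝ} (hr : 0 ≤ r)
    (h : ∀ i, |a i - b i| ≤ r) :
    Real.log (1 + ∑ j, Real.exp (a j)) ≤ Real.log (1 + ∑ j, Real.exp (b j)) + r := by
  have hb : 0 < 1 + ∑ j, Real.exp (b j) := by positivity
  have ha : 0 < 1 + ∑ j, Real.exp (a j) := by positivity
  have hle : 1 + ∑ j, Real.exp (a j) ≤ (1 + ∑ j, Real.exp (b j)) * Real.exp r := by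
    rw [add_mul, one_mul, Finset.sum_mul]
    refine add_le_add (Real.one_le_exp hr) (Finset.sum_le_sum fun j _ => ?_)
    rw [← Real.exp_add, Real.exp_le_exp]
    linarith [(abs_le.1 (h j)).2]
  calc Real.log (1 + ∑ j, Real.exp (a j))
      ≤ Real.log ((1 + ∑ j, Real.exp (b j)) * Real.exp r) := Real.log_le_log ha hle
    _ = _ := by rw [Real.log_mul hb.ne' (Real.exp_ne_zero _), Real.log_exp]

theorem abs_loss_sub_loss_le {n : ℕ} (y : Outcome n) {a b : Decision n} {r : ℝ} (hr : 0 ≤ r)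
    (h : ∀ i, |a i - b i| ≤ r) : |loss y a - loss y b| ≤ 2 * r := by
  have h1 := log_one_add_sum_exp_le hr h
  have h2 := log_one_add_sum_exp_le (a := b) (b := a) hr fun i => by
    rw [abs_sub_comm]; exact h i
  have h3 : |(Fin.snoc a 0 : Fin (n + 1) → ℝ) y - (Fin.snoc b 0 : Fin (n + 1) → ℝ) y| ≤ r := by
    refine Fin.lastCases ?_ (fun i => ?_) y
    · simpa using hr
    · simpa using h i
  rw [abs_le] at h3
  rw [loss_eq, loss_eq, abs_le]
  constructor <;> linarith

/-- The loss lies in an interval whose length does not depend on the number of targets: it stays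
close to the loss `log (n + 1)` of the uniform prediction. -/
theorem loss_mem_Icc {n : ℕ} (y : Outcome n) {a : Decision n} {M : ℝ} (hM : 0 ≤ M)
    (h : ∀ i, |a i| ≤ M / 2) :
    loss y a ∈ Set.Icc (Real.log (n + 1) - M) (Real.log (n + 1) + M) := by
  have h0 : loss y (0 : Decision n) = Real.log (n + 1) := by
    have hy : (Fin.snoc (0 : Decision n) 0 : Fin (n + 1) → ℝ) y = 0 := by
      refine Fin.lastCases ?_ (fun i => ?_) y <;> simp
    rw [loss_eq, hy]
    simp [add_comm]
  have := abs_loss_sub_loss_le y (a := a) (b := 0) (r := M / 2) (by linarith) (by simpa using h)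
  rw [h0, abs_le] at this
  constructor <;> linarith

theorem loss_nonneg {n : ℕ} (y : Outcome n) (a : Decision n) : 0 ≤ loss y a := by
  have hs : 0 ≤ ∑ j, Real.exp (a j) := by positivity
  rw [loss_eq, sub_nonneg, Real.le_log_iff_exp_le (by positivity)]
  refine Fin.lastCases ?_ (fun i => ?_) y
  · simpa using hs
  · have := Finset.single_le_sum (f := fun j => Real.exp (a j))
      (fun j _ => (Real.exp_pos _).le) (Finset.mem_univ i)
    simp only [Fin.snoc_castSucc]
    linarith

/-- The hypothesis with weight `w` and offsets `c`. -/
def suqrHyp {n : ℕ} (K : ℕ) (w : ℝ) (c : Fin n → ℝ) : Strategy n K → Decision n :=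
  fun x i => w * relCoverage x i + c i

theorem abs_weight_mul_relCoverage_le {n K : ℕ} {w r : ℝ} (hw : |w| ≤ r) (x : Strategy n K)
    (i : Fin n) : |w * relCoverage x i| ≤ r := by
  rw [abs_mul]
  exact (mul_le_of_le_one_right (abs_nonneg _) (abs_relCoverage_le x i)).trans hw

/-- Up to equality of functions, the hypotheses are parametrized by a cube of dimension
`n + 1`. -/
theorem mem_suqrClass_iff {n K : ℕ} {M : ℝ} (hM : 0 < M) {h : Strategy n K → Decision n} :
    h ∈ suqrClass n K M ↔
      ∃ (w : ℝ) (c : Fin n → ℝ), |w| ≤ M / 4 ∧ (∀ i, |c i| ≤ M / 4) ∧ h = suqrHyp K w c := by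
  constructor
  · rintro ⟨w, c, hh, hw, hc⟩
    obtain ⟨v, hv, hwv⟩ := exists_abs_le_weight (by positivity) hw
    refine ⟨v, c, hv, hc, ?_⟩
    ext x i
    rw [hh, hwv, suqrHyp]
  · rintro ⟨w, c, hw, hc, rfl⟩
    exact ⟨w, c, fun _ _ => rfl, abs_weight_mul_relCoverage_le hw, hc⟩

theorem loss_suqrHyp_mem_Icc {n K : ℕ} {M w : ℝ} {c : Fin n → ℝ} (hM : 0 < M)
    (hw : |w| ≤ M / 4) (hc : ∀ i, |c i| ≤ M / 4) (z : Datum n K) :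
    loss z.2 (suqrHyp K w c z.1) ∈ Set.Icc (Real.log (n + 1) - M) (Real.log (n + 1) + M) := by
  refine loss_mem_Icc _ hM.le fun i => (abs_add_le _ _).trans ?_
  linarith [abs_weight_mul_relCoverage_le hw z.1 i, hc i]

theorem measurable_loss_suqrHyp {n K : ℕ} (w : ℝ) (c : Fin n → ℝ) :
    Measurable fun z : Datum n K => loss z.2 (suqrHyp K w c z.1) := by
  refine measurable_from_prod_countable_left fun y => ?_
  have hh : ∀ i, Measurable fun x : Strategy n K => suqrHyp K w c x i := fun i =>
    ((measurable_relCoverage i).const_mul w).add_const _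
  simp only [loss_eq]
  refine (Real.measurable_log.comp ((Finset.measurable_sum _ fun i _ =>
    Real.measurable_exp.comp (hh i)).const_add 1)).sub ?_
  refine Fin.lastCases ?_ (fun i => ?_) y
  · simp
  · simpa using hh i

theorem integrable_loss_suqrHyp {n K : ℕ} {M w : ℝ} {c : Fin n → ℝ} (hM : 0 < M)
    (hw : |w| ≤ M / 4) (hc : ∀ i, |c i| ≤ M / 4) (p : Measure (Datum n K))
    [IsProbabilityMeasure p] :
    Integrable (fun z : Datum n K => loss z.2 (suqrHyp K w c z.1)) p :=
  Integrable.of_mem_Icc _ _ (measurable_loss_suqrHyp w c).aemeasurable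
    (Filter.Eventually.of_forall (loss_suqrHyp_mem_Icc hM hw hc))

/-! ### Uniform convergence of the empirical risk -/

/-- **Hoeffding's inequality**, two-sided, for the deviation of the empirical mean of a function
with values in `[a, b]`. For `m = 0` or `a = b` the right-hand side is `2`. -/
theorem measureReal_abs_mean_sub_integral_ge_le {Ω : Type*} [MeasurableSpace Ω] (p : Measure Ω)
    [IsProbabilityMeasure p] {f : Ω → ℝ} (hf : Measurable f) {a b : ℝ}
    (hab : ∀ ω, f ω ∈ Set.Icc a b) (m : ℕ) {t : ℝ} (ht : 0 ≤ t) :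
    (Measure.pi fun _ : Fin m => p).real
        {z | t ≤ |(1 / (m : ℝ)) * ∑ j, f (z j) - ∫ ω, f ω ∂p|} ≤
      2 * Real.exp (-(2 * m * t ^ 2 / (b - a) ^ 2)) := by
  rcases m.eq_zero_or_pos with rfl | hm
  · refine measureReal_le_one.trans ?_
    simp
  have hmR : (0 : ℝ) < m := by exact_mod_cast hm
  set μ := Measure.pi fun _ : Fin m => p
  set E := ∫ ω, f ω ∂p
  have hsub : ProbabilityTheory.HasSubgaussianMGF (fun ω => f ω - E) ((‖b - a‖₊ / 2) ^ 2) p :=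
    ProbabilityTheory.hasSubgaussianMGF_of_mem_Icc hf.aemeasurable
      (Filter.Eventually.of_forall hab)
  -- One tail of the sum, for either sign of the centred function.
  have tail : ∀ g : Ω → ℝ, Measurable g →
      ProbabilityTheory.HasSubgaussianMGF g ((‖b - a‖₊ / 2) ^ 2) p →
      μ.real {z | m * t ≤ ∑ j, g (z j)} ≤ Real.exp (-(2 * m * t ^ 2 / (b - a) ^ 2)) := by
    intro g hg hgs
    have hind : ProbabilityTheory.iIndepFun (fun (j : Fin m) (z : Fin m → Ω) => g (z j)) μ :=
      ProbabilityTheory.iIndepFun_pi fun _ => hg.aemeasurable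
    have hc : ∀ j ∈ Finset.univ, ProbabilityTheory.HasSubgaussianMGF
        (fun z : Fin m → Ω => g (z j)) ((‖b - a‖₊ / 2) ^ 2) μ := fun j _ => by
      refine ProbabilityTheory.HasSubgaussianMGF.of_map (Y := fun z : Fin m → Ω => z j)
        (measurable_pi_apply j).aemeasurable ?_
      rwa [(measurePreserving_eval (fun _ : Fin m => p) j).map_eq]
    refine (ProbabilityTheory.HasSubgaussianMGF.measure_sum_ge_le_of_iIndepFun hind hc
      (mul_nonneg hmR.le ht)).trans_eq ?_
    congr 1
    have hsq : |b - a| ^ 2 = (b - a) ^ 2 := sq_abs _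
    simp only [Finset.sum_const, Finset.card_univ, Fintype.card_fin, nsmul_eq_mul]
    push_cast
    rw [Real.norm_eq_abs, div_pow, hsq]
    rcases eq_or_ne (b - a) 0 with h0 | h0
    · simp [h0]
    · field_simp
  have hsplit : {z : Fin m → Ω | t ≤ |(1 / (m : ℝ)) * ∑ j, f (z j) - E|} ⊆
      {z | m * t ≤ ∑ j, (f (z j) - E)} ∪ {z | m * t ≤ ∑ j, -(f (z j) - E)} := by
    intro z hz
    have hmean : (m : ℝ) * ((1 / (m : ℝ)) * ∑ j, f (z j) - E) = ∑ j, (f (z j) - E) := by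
      rw [Finset.sum_sub_distrib]
      simp only [Finset.sum_const, Finset.card_univ, Fintype.card_fin, nsmul_eq_mul]
      field_simp
    rcases le_abs.1 (show t ≤ |(1 / (m : ℝ)) * ∑ j, f (z j) - E| from hz) with h | h
    · left
      rw [Set.mem_ofPred_eq, ← hmean]
      exact mul_le_mul_of_nonneg_left h hmR.le
    · right
      rw [Set.mem_ofPred_eq, Finset.sum_neg_distrib, ← hmean, ← mul_neg]
      exact mul_le_mul_of_nonneg_left h hmR.le
  calc μ.real _ ≤ μ.real _ := measureReal_mono hsplit
    _ ≤ _ := measureReal_union_le _ _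
    _ ≤ _ := add_le_add (tail _ (hf.sub_const E) hsub) (tail _ (hf.sub_const E).neg hsub.neg)
    _ = _ := by ring

theorem abs_empRisk_sub_empRisk_le {n K m : ℕ} {r : ℝ} (hr : 0 ≤ r)
    {h f : Strategy n K → Decision n}
    (H : ∀ (x : Strategy n K) y, |loss y (h x) - loss y (f x)| ≤ r) (z : Fin m → Datum n K) :
    |empRisk z h - empRisk z f| ≤ r := by
  rw [empRisk, empRisk, ← mul_sub, ← Finset.sum_sub_distrib, abs_mul, abs_of_nonneg (by positivity)]
  rcases m.eq_zero_or_pos with rfl | hm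
  · simpa using hr
  have hmR : (0 : ℝ) < m := by exact_mod_cast hm
  calc 1 / (m : ℝ) * |∑ j, (loss (z j).2 (h (z j).1) - loss (z j).2 (f (z j).1))|
      ≤ 1 / (m : ℝ) * ∑ _j : Fin m, r := by
        gcongr
        exact (Finset.abs_sum_le_sum_abs _ _).trans (Finset.sum_le_sum fun j _ => H _ _)
    _ = r := by simp; field_simp

theorem abs_trueRisk_sub_trueRisk_le {n K : ℕ} {r : ℝ} {p : Measure (Datum n K)}
    [IsProbabilityMeasure p] {h f : Strategy n K → Decision n}
    (hh : Integrable (fun z => loss z.2 (h z.1)) p) (hf : Integrable (fun z => loss z.2 (f z.1)) p)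
    (H : ∀ (x : Strategy n K) y, |loss y (h x) - loss y (f x)| ≤ r) :
    |trueRisk p h - trueRisk p f| ≤ r := by
  have hb : ∀ᵐ z ∂p, ‖loss z.2 (h z.1) - loss z.2 (f z.1)‖ ≤ r :=
    Filter.Eventually.of_forall fun z => H z.1 z.2
  rw [trueRisk, trueRisk, ← integral_sub hh hf, ← Real.norm_eq_abs]
  simpa using norm_integral_le_of_norm_le_const hb

/-- The event that uniform convergence fails is covered by the deviation events of the finitely
many hypotheses with parameters on a grid of radius `α / 36`: moving to the grid changes each
exponent by at most `α / 18`, hence each of the two risks by at most `α / 9`. -/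
theorem uniformlyConverges_suqrClass {n K m : ℕ} {M α δ : ℝ} (hM : 0 < M) (hα : 0 < α)
    (hm : (⌈9 * M / α⌉₊ : ℝ) ^ (n + 1) * (2 * Real.exp (-(m * α ^ 2 / (162 * M ^ 2)))) < δ / 2)
    (p : Measure (Datum n K)) [IsProbabilityMeasure p] :
    UniformlyConverges (suqrClass n K M) α δ m p := by
  obtain ⟨S, hcard, hS, hcov⟩ :=
    exists_finset_cover_abs_le (r := M / 4) (ε := α / 36) (by positivity) (by positivity)
  have hceil : M / 4 / (α / 36) = 9 * M / α := by field_simp; norm_num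
  rw [hceil] at hcard
  set I := S ×ˢ Fintype.piFinset fun _ : Fin n => S with hI
  have hIw : ∀ q ∈ I, |q.1| ≤ M / 4 := fun q hq => hS _ (Finset.mem_product.1 hq).1
  have hIc : ∀ q ∈ I, ∀ i, |q.2 i| ≤ M / 4 := fun q hq i =>
    hS _ (Fintype.mem_piFinset.1 (Finset.mem_product.1 hq).2 i)
  let B : ℝ × (Fin n → ℝ) → Set (Fin m → Datum n K) := fun q =>
    {z | α / 9 ≤ |empRisk z (suqrHyp K q.1 q.2) - trueRisk p (suqrHyp K q.1 q.2)|}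
  have hB : ∀ q ∈ I, (sampleLaw p m).real (B q) ≤
      2 * Real.exp (-(m * α ^ 2 / (162 * M ^ 2))) := fun q hq => by
    refine (measureReal_abs_mean_sub_integral_ge_le p (measurable_loss_suqrHyp q.1 q.2)
      (loss_suqrHyp_mem_Icc hM (hIw q hq) (hIc q hq)) m (t := α / 9) (by positivity)).trans_eq ?_
    congr 3
    rw [show Real.log (n + 1) + M - (Real.log (n + 1) - M) = 2 * M by ring]
    field_simp
    ring
  have hsub : {z : Fin m → Datum n K |
      ¬ ∀ h ∈ suqrClass n K M, |empRisk z h - trueRisk p h| < α / 3} ⊆ ⋃ q ∈ I, B q := by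
    intro z hz
    by_contra hcon
    simp only [Set.mem_iUnion, not_exists] at hcon
    refine hz fun h hh => ?_
    obtain ⟨w, c, hw, hc, rfl⟩ := (mem_suqrClass_iff hM).1 hh
    obtain ⟨v, hvS, hv⟩ := hcov w hw
    choose d hdS hd using fun i => hcov (c i) (hc i)
    have hq : (v, d) ∈ I := Finset.mem_product.2 ⟨hvS, Fintype.mem_piFinset.2 hdS⟩
    have hloss : ∀ (x : Strategy n K) y,
        |loss y (suqrHyp K w c x) - loss y (suqrHyp K v d x)| ≤ α / 9 := fun x y => by
      have := abs_loss_sub_loss_le y (a := suqrHyp K w c x) (b := suqrHyp K v d x) (r := α / 18)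
        (by positivity) fun i => by
          rw [suqrHyp, suqrHyp, add_sub_add_comm, ← sub_mul]
          refine (abs_add_le _ _).trans ?_
          have h1 := abs_weight_mul_relCoverage_le (w := w - v) (r := α / 36)
            (by rw [abs_sub_comm]; exact hv) x i
          have h2 := hd i
          rw [abs_sub_comm] at h2
          linarith
      linarith
    have h1 := abs_empRisk_sub_empRisk_le (by positivity) hloss z
    have h2 := abs_trueRisk_sub_trueRisk_le (integrable_loss_suqrHyp hM hw hc p)
      (integrable_loss_suqrHyp hM (hIw _ hq) (hIc _ hq) p) hloss
    have h3 : |empRisk z (suqrHyp K v d) - trueRisk p (suqrHyp K v d)| < α / 9 :=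
      not_le.1 (hcon (v, d) hq)
    rw [abs_le] at h1 h2
    rw [abs_lt] at h3 ⊢
    constructor <;> linarith
  have hprob : IsProbabilityMeasure (sampleLaw p m) := by
    unfold sampleLaw; infer_instance
  have hlt : (sampleLaw p m).real (⋃ q ∈ I, B q) < δ / 2 := by
    refine lt_of_le_of_lt ?_ hm
    calc (sampleLaw p m).real (⋃ q ∈ I, B q) ≤ ∑ q ∈ I, (sampleLaw p m).real (B q) :=
          measureReal_biUnion_finset_le _ _
      _ ≤ ∑ _q ∈ I, 2 * Real.exp (-(m * α ^ 2 / (162 * M ^ 2))) := Finset.sum_le_sum hB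
      _ = (S.card : ℝ) ^ (n + 1) * (2 * Real.exp (-(m * α ^ 2 / (162 * M ^ 2)))) := by
          rw [Finset.sum_const, nsmul_eq_mul, hI, Finset.card_product, Fintype.card_piFinset]
          simp [pow_succ']
      _ ≤ _ := by gcongr
  refine (measure_mono hsub).trans_lt ?_
  rw [← ofReal_measureReal (measure_ne_top _ _)]
  exact (ENNReal.ofReal_lt_ofReal_iff (measureReal_nonneg.trans_lt hlt)).2 hlt

/-! ### Learnability and the resulting guarantee -/

theorem empRisk_nonneg {n K m : ℕ} (z : Fin m → Datum n K) (h : Strategy n K → Decision n) :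
    0 ≤ empRisk z h :=
  mul_nonneg (by positivity) (Finset.sum_nonneg fun _ _ => loss_nonneg _ _)

theorem bddBelow_empRisk_image {n K m : ℕ} (z : Fin m → Datum n K)
    (H : Set (Strategy n K → Decision n)) : BddBelow (empRisk z '' H) :=
  ⟨0, by rintro _ ⟨h, -, rfl⟩; exact empRisk_nonneg z h⟩

theorem bddBelow_trueRisk_image {n K : ℕ} (p : Measure (Datum n K))
    (H : Set (Strategy n K → Decision n)) : BddBelow (trueRisk p '' H) :=
  ⟨0, by rintro _ ⟨h, -, rfl⟩; exact integral_nonneg fun _ => loss_nonneg _ _⟩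

/-- For a nonempty class, uniform convergence is all that learnability requires: some algorithm
minimizes the empirical risk up to `α / 3` on every sample. -/
theorem pacLearnable_of_uniformlyConverges {n K m : ℕ} {H : Set (Strategy n K → Decision n)}
    (hH : H.Nonempty) {α δ : ℝ} (hα : 0 < α) (hδ : 0 < δ)
    (hu : ∀ p : Measure (Datum n K), IsProbabilityMeasure p → UniformlyConverges H α δ m p) :
    PACLearnable H α δ m := by
  have hex : ∀ z : Fin m → Datum n K, ∃ h ∈ H, |empRisk z h - sInf (empRisk z '' H)| < α / 3 := by
    intro z
    obtain ⟨_, ⟨h, hh, rfl⟩, hlt⟩ := Real.lt_sInf_add_pos (hH.image (empRisk z))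
      (show 0 < α / 3 by positivity)
    refine ⟨h, hh, ?_⟩
    have := csInf_le (bddBelow_empRisk_image z H) (Set.mem_image_of_mem _ hh)
    rw [abs_lt]
    constructor <;> linarith
  choose A hA hmin using hex
  refine ⟨A, hA, fun p hp => ⟨hu p hp, ?_⟩⟩
  have : {z | ¬ |empRisk z (A z) - sInf (empRisk z '' H)| < α / 3} = ∅ :=
    Set.eq_empty_of_forall_notMem fun z hz => hz (hmin z)
  rw [MinimizesEmpRisk, this, measure_empty]
  exact ENNReal.ofReal_pos.2 (by positivity)

/-- If two functions are uniformly close on a set, so are their infima. -/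
theorem abs_sInf_image_sub_sInf_image_le {E : Type*} {s : Set E} (hs : s.Nonempty) {f g : E → ℝ}
    (hf : BddBelow (f '' s)) (hg : BddBelow (g '' s)) {r : ℝ} (h : ∀ x ∈ s, |f x - g x| ≤ r) :
    |sInf (f '' s) - sInf (g '' s)| ≤ r := by
  have h1 : sInf (f '' s) - r ≤ sInf (g '' s) := by
    refine le_csInf (hs.image g) ?_
    rintro _ ⟨x, hx, rfl⟩
    linarith [csInf_le hf (Set.mem_image_of_mem f hx), (abs_le.1 (h x hx)).2]
  have h2 : sInf (g '' s) - r ≤ sInf (f '' s) := by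
    refine le_csInf (hs.image f) ?_
    rintro _ ⟨x, hx, rfl⟩
    linarith [csInf_le hg (Set.mem_image_of_mem g hx), (abs_le.1 (h x hx)).1]
  rw [abs_le]
  constructor <;> linarith

theorem hasPACGuarantee_of_uniformlyConverges {n K m : ℕ} {H : Set (Strategy n K → Decision n)}
    {α δ : ℝ} (hδ : 0 < δ) {p : Measure (Datum n K)}
    {A : (Fin m → Datum n K) → Strategy n K → Decision n} (hA : ∀ z, A z ∈ H)
    (hu : UniformlyConverges H α δ m p) (hmin : MinimizesEmpRisk H α δ m p A) :
    HasPACGuarantee H α δ m p A := by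
  have hsub : {z | ¬ |trueRisk p (A z) - sInf (trueRisk p '' H)| < α} ⊆
      {z | ¬ ∀ h ∈ H, |empRisk z h - trueRisk p h| < α / 3} ∪
        {z | ¬ |empRisk z (A z) - sInf (empRisk z '' H)| < α / 3} := by
    intro z hz
    by_contra hcon
    simp only [Set.mem_union, Set.mem_ofPred_eq, not_or, not_not] at hcon
    refine hz ?_
    have h1 := hcon.1 _ (hA z)
    have h2 := hcon.2
    have h3 := abs_sInf_image_sub_sInf_image_le ⟨_, hA z⟩ (bddBelow_empRisk_image z H)
      (bddBelow_trueRisk_image p H) fun h hh => (hcon.1 h hh).le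
    rw [abs_lt] at h1 h2 ⊢
    rw [abs_le] at h3
    constructor <;> linarith
  have hsum : ENNReal.ofReal (δ / 2) + ENNReal.ofReal (δ / 2) = ENNReal.ofReal δ := by
    rw [← ENNReal.ofReal_add (by positivity) (by positivity), add_halves]
  rw [HasPACGuarantee, ← hsum]
  exact ((measure_mono hsub).trans (measure_union_le _ _)).trans_lt (ENNReal.add_lt_add hu hmin)

theorem pacLearnable_of_sampleComplexity_le {n K m : ℕ} {H : Set (Strategy n K → Decision n)}
    {α δ : ℝ} (h : sampleComplexity H α δ ≤ m) : PACLearnable H α δ m := by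
  have hlt : sampleComplexity H α δ < ((m + 1 : ℕ) : ℕ∞) :=
    h.trans_lt (by exact_mod_cast Nat.lt_succ_self m)
  simp only [sampleComplexity, iInf_lt_iff] at hlt
  obtain ⟨m₀, hm₀, hlt⟩ := hlt
  exact hm₀ m (Nat.lt_succ_iff.1 (by exact_mod_cast hlt))

/-- The sample size at which the union bound over the grid is strong enough. The logarithm of the
grid size is at most a multiple of `T log (T / α)` because `T / α ≥ 2`. -/
theorem grid_card_mul_exp_lt {n m : ℕ} (hn : 1 ≤ n) {M α δ : ℝ} (hM : 0 < M) (hα : 0 < α)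
    (hαT : α ≤ ((n : ℝ) + 1) / 2) (hδ : 0 < δ) (hδ1 : δ < 1)
    (hm : 162 * M ^ 2 * (2 + 18 * M) * (1 / α ^ 2 *
      (Real.log (1 / δ) + ((n : ℝ) + 1) * Real.log (((n : ℝ) + 1) / α))) ≤ m) :
    (⌈9 * M / α⌉₊ : ℝ) ^ (n + 1) * (2 * Real.exp (-(m * α ^ 2 / (162 * M ^ 2)))) < δ / 2 := by
  set T : ℝ := (n : ℝ) + 1 with hT
  have hT2 : 2 ≤ T := by
    have : (1 : ℝ) ≤ n := by exact_mod_cast hn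
    linarith
  have hTα : 2 ≤ T / α := by rw [le_div_iff₀ hα]; linarith
  set L := Real.log (1 / δ) with hL
  have hL0 : 0 < L := Real.log_pos (by rw [lt_div_iff₀ hδ]; linarith)
  set ℓ := Real.log (T / α) with hℓ
  have hlog2 : Real.log 2 ≤ ℓ := Real.log_le_log (by norm_num) hTα
  have hhalf : 1 / 2 < Real.log 2 := by linarith [Real.log_two_gt_d9]
  have hN0 : (0 : ℝ) < ⌈9 * M / α⌉₊ := by
    exact_mod_cast Nat.ceil_pos.2 (by positivity)
  -- `⌈9M/α⌉ ≤ 9M/α + 1 ≤ (T/α)(9M + 1)`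
  have hN : (⌈9 * M / α⌉₊ : ℝ) ≤ T / α * (9 * M + 1) := by
    have h1 := (Nat.ceil_lt_add_one (show 0 ≤ 9 * M / α by positivity)).le
    have h2 : 9 * M / α ≤ T / α * (9 * M) := by
      rw [div_mul_eq_mul_div]
      exact div_le_div_of_nonneg_right
        (le_mul_of_one_le_left (by positivity) (by linarith)) hα.le
    linarith
  have hlogN : Real.log (⌈9 * M / α⌉₊ : ℝ) ≤ (1 + 18 * M) * ℓ := by
    have h1 := Real.log_le_log hN0 hN
    rw [Real.log_mul (by positivity) (by positivity)] at h1
    have h2 := Real.log_le_sub_one_of_pos (show 0 < 9 * M + 1 by positivity)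
    nlinarith
  set X := (m : ℝ) * α ^ 2 / (162 * M ^ 2) with hX
  have hXge : (2 + 18 * M) * (L + T * ℓ) ≤ X := by
    rw [hX, le_div_iff₀ (by positivity)]
    calc (2 + 18 * M) * (L + T * ℓ) * (162 * M ^ 2)
        = 162 * M ^ 2 * (2 + 18 * M) * (1 / α ^ 2 * (L + T * ℓ)) * α ^ 2 := by field_simp
      _ ≤ m * α ^ 2 := by gcongr
  have hlog4 : Real.log 4 ≤ T * ℓ := by
    rw [show (4 : ℝ) = 2 ^ 2 by norm_num, Real.log_pow]
    push_cast
    exact mul_le_mul hT2 hlog2 (by linarith) (by linarith)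
  have hkey : T * Real.log (⌈9 * M / α⌉₊ : ℝ) + Real.log 4 - X < -L := by
    have h1 : T * Real.log (⌈9 * M / α⌉₊ : ℝ) ≤ T * ((1 + 18 * M) * ℓ) := by gcongr
    nlinarith [mul_pos hM hL0]
  have hexp := Real.exp_lt_exp.2 hkey
  have hδexp : Real.exp (-L) = δ := by
    rw [hL, one_div, Real.log_inv, neg_neg, Real.exp_log hδ]
  have hNexp : Real.exp (T * Real.log (⌈9 * M / α⌉₊ : ℝ)) = (⌈9 * M / α⌉₊ : ℝ) ^ (n + 1) := by
    rw [← Real.exp_log (pow_pos hN0 (n + 1)), Real.log_pow]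
    push_cast
    rfl
  rw [hδexp, sub_eq_add_neg, Real.exp_add, Real.exp_add, Real.exp_log (by norm_num), hNexp] at hexp
  linarith

theorem suqrClass_nonempty (n K : ℕ) {M : ℝ} (hM : 0 < M) : (suqrClass n K M).Nonempty :=
  ⟨suqrHyp K 0 0, (mem_suqrClass_iff hM).2
    ⟨0, 0, by rw [abs_zero]; positivity, fun _ => by simp; positivity, rfl⟩⟩

theorem sampleComplexity_suqrClass_le {n K : ℕ} (hn : 1 ≤ n) {M α δ : ℝ} (hM : 0 < M)
    (hα : 0 < α) (hαT : α ≤ ((n : ℝ) + 1) / 2) (hδ : 0 < δ) (hδ1 : δ < 1) :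
    sampleComplexity (suqrClass n K M) α δ ≤
      (⌈162 * M ^ 2 * (2 + 18 * M) * (1 / α ^ 2 * (Real.log (1 / δ) +
        ((n : ℝ) + 1) * Real.log (((n : ℝ) + 1) / α)))⌉₊ : ℕ∞) :=
  iInf₂_le _ fun _ hm => pacLearnable_of_uniformlyConverges (suqrClass_nonempty n K hM) hα hδ
    fun p _ => uniformlyConverges_suqrClass hM hα
      (grid_card_mul_exp_lt hn hM hα hαT hδ hδ1 (Nat.ceil_le.1 hm)) p

end SUQR

theorem mainTheorem2 (M : ℝ) (hM : 0 < M) :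
    -- decomposition and capacity bounds, for `T = n + 1 ≥ 2` targets
    (∀ n K : ℕ, 1 ≤ n →
      SUQR.suqrClass n K M
        = SUQR.semiFreeSum (SUQR.weightClass n K M) (fun _ => SUQR.constClass n K M) ∧
      ∀ ε : ℝ, 0 < ε →
        SUQR.capacity ε (SUQR.suqrClass n K M) SUQR.avgDist
            ≤ SUQR.capacity (ε / 2) (SUQR.weightClass n K M) SUQR.avgDist
              * ∏ _i : Fin n, SUQR.capacity (ε / 2) (SUQR.constClass n K M) SUQR.absDist ∧
        SUQR.capacity ε (SUQR.weightClass n K M) SUQR.avgDist ≤ (⌈M / (4 * ε)⌉₊ : ℕ∞) ∧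
        SUQR.capacity ε (SUQR.constClass n K M) SUQR.absDist ≤ (⌈M / (4 * ε)⌉₊ : ℕ∞) ∧
        SUQR.capacity ε (SUQR.suqrClass n K M) SUQR.avgDist
            ≤ (⌈M / (2 * ε)⌉₊ : ℕ∞) ^ (n + 1)) ∧
    -- sample complexity, with a constant that depends on `M` only
    (∃ C : ℝ, 0 < C ∧ ∀ n K : ℕ, 1 ≤ n → ∀ T : ℝ, T = (n : ℝ) + 1 →
      ∀ α δ : ℝ, 0 < α → α ≤ T / 2 → 0 < δ → δ < 1 →
        SUQR.sampleComplexity (SUQR.suqrClass n K M) α δ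
            ≤ (⌈C * (1 / α ^ 2 * (Real.log (1 / δ) + T * Real.log (T / α)))⌉₊ : ℕ∞) ∧
        ∀ m : ℕ, SUQR.sampleComplexity (SUQR.suqrClass n K M) α δ ≤ (m : ℕ∞) →
          ∀ A : (Fin m → SUQR.Datum n K) → SUQR.Strategy n K → SUQR.Decision n,
            (∀ z, A z ∈ SUQR.suqrClass n K M) →
            ∀ p : MeasureTheory.Measure (SUQR.Datum n K),
              MeasureTheory.IsProbabilityMeasure p →
              SUQR.MinimizesEmpRisk (SUQR.suqrClass n K M) α δ m p A →
              SUQR.HasPACGuarantee (SUQR.suqrClass n K M) α δ m p A) := by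
  refine ⟨fun n K hn => ⟨SUQR.suqrClass_eq_semiFreeSum n K M, fun ε hε =>
    ⟨SUQR.capacity_suqrClass_le_mul hn K hM hε, SUQR.capacity_weightClass_le n K hM hε,
      SUQR.capacity_constClass_le n K hM hε, SUQR.capacity_suqrClass_le hn K hM hε⟩⟩,
    162 * M ^ 2 * (2 + 18 * M), by positivity, ?_⟩
  rintro n K hn T rfl α δ hα hαT hδ hδ1
  refine ⟨SUQR.sampleComplexity_suqrClass_le hn hM hα hαT hδ hδ1, ?_⟩
  intro m hm A hA p hp hmin
  obtain ⟨_, -, hlearn⟩ := SUQR.pacLearnable_of_sampleComplexity_le hm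
  exact SUQR.hasPACGuarantee_of_uniformlyConverges hδ hA (hlearn p hp).1 hmin
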